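/- Let $R$ be a commutative ring. Let $\mathcal C_R$ be the additive category whose objects are the projective $R$-modules and whose morphisms are $\mathrm{Hom}_{\mathcal C_R}(M,M')=\mathrm{Hom}_R(M,M')/\mathrm{Hom}_f(M,M')$, where $\mathrm{Hom}_f(M,M')$ is the group of $R$-linear maps whose image is contained in a finitely generated submodule of $M'$. Let $\mathcal C_R^{\mathrm{Kar}}$ (the Calkin category of $R$) be the idempotent completion of $\mathcal C_R$, and put $K_{-1}(R):=K_0(\mathcal C_R^{\mathrm{Kar}})$, the universal abelian group with a class $[X]$ for every object $X$ of $\mathcal C_R^{\mathrm{Kar}}$ such that $[X\oplus Y]=[X]+[Y]$. For a commutative $R$-algebra $R'$, the functor $M\mapsto R'\otimes_R M$ induces a homomorphism $K_{-1}(R)\to K_{-1}(R')$. A morphism $\pi:X\to\operatorname{Spec}R$ is called a Nisnevich covering if it is étale and there are closed subschemes $\operatorname{Spec}R=F_0\supset F_1\supset\dots\supset F_n=\emptyset$, each defined by finitely many equations, such that $\pi$ admits a section over $F_{i-1}\setminus F_i$ for $i=1,\dots,n$. Theorem. (i) Every element of $K_{-1}(R)$ vanishes Nisnevich-locally: for every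 $x\in K_{-1}(R)$ there is a commutative $R$-algebra $R'$ such that $\operatorname{Spec}R'\to\operatorname{Spec}R$ is a Nisnevich covering and the image of $x$ in $K_{-1}(R')$ is $0$. (ii) If $R$ is a Henselian local ring, then $K_{-1}(R)=0$. -/

import Mathlib

open CategoryTheory CategoryTheory.Limits CategoryTheory.Idempotents AlgebraicGeometry

open scoped TensorProduct

universe u

noncomputable section

/-! ### `K₀` of an additive category -/

section KZero

variable (A : Type*) [Category* A] [Preadditive A]

/-- The subgroup of relations in the free abelian group on the objects of `A`: it is generated by
`[X ⊕ Y] - [X] - [Y]`, for every biproduct `X ⊕ Y` in `A`. As `X` is a biproduct of `Y` and of a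
zero object when `X ≅ Y`, isomorphic objects are identified. -/
def KZeroRelations : AddSubgroup (FreeAbelianGroup A) :=
  AddSubgroup.closure {z | ∃ (X Y : A) (b : BinaryBicone X Y), Nonempty b.IsBilimit ∧
    z = FreeAbelianGroup.of b.pt - FreeAbelianGroup.of X - FreeAbelianGroup.of Y}

/-- `K₀` of an additive category: the universal abelian group with a class `[X]` for every
object `X`, such that `[X ⊕ Y] = [X] + [Y]`. -/
def KZero [HasFiniteBiproducts A] : Type _ :=
  FreeAbelianGroup A ⧸ KZeroRelations A

instance [HasFiniteBiproducts A] : AddCommGroup (KZero A) :=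
  inferInstanceAs (AddCommGroup (FreeAbelianGroup A ⧸ KZeroRelations A))

variable {A}

/-- The class of an object in `K₀`. -/
def KZero.mk [HasFiniteBiproducts A] (X : A) : KZero A :=
  QuotientAddGroup.mk (FreeAbelianGroup.of X)

/-- The map `[X] ↦ [F X]` on `K₀` induced by an additive functor `F`. -/
def KZero.map {B : Type*} [Category* B] [Preadditive B] [HasFiniteBiproducts A]
    [HasFiniteBiproducts B] (F : A ⥤ B) [F.Additive] : KZero A →+ KZero B :=
  QuotientAddGroup.map (KZeroRelations A) (KZeroRelations B) (FreeAbelianGroup.map F.obj) (by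
    refine (AddSubgroup.closure_le _).2 ?_
    rintro _ ⟨X, Y, b, ⟨hb⟩, rfl⟩
    have : PreservesBinaryBiproduct X Y F := preservesBinaryBiproduct_of_preservesBiproduct F X Y
    refine AddSubgroup.subset_closure ⟨F.obj X, F.obj Y, F.mapBinaryBicone b,
      ⟨isBinaryBilimitOfPreserves F hb⟩, ?_⟩
    simp [map_sub])

end KZero

/-! ### The Calkin category -/

section Calkin

/-- The `R`-linear maps `M → N` whose image is contained in a finitely generated submodule. -/
def finiteImageMaps (R : Type*) [CommRing R] (M N : Type*) [AddCommGroup M] [Module R M]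
    [AddCommGroup N] [Module R N] : AddSubgroup (M →ₗ[R] N) where
  carrier := {f | ∃ P : Submodule R N, P.FG ∧ LinearMap.range f ≤ P}
  zero_mem' := ⟨⊥, Submodule.fg_bot, by rintro _ ⟨x, rfl⟩; simp⟩
  add_mem' := by
    rintro f g ⟨P, hP, hf⟩ ⟨Q, hQ, hg⟩
    refine ⟨P ⊔ Q, hP.sup hQ, ?_⟩
    rintro _ ⟨x, rfl⟩
    exact Submodule.add_mem_sup (hf ⟨x, rfl⟩) (hg ⟨x, rfl⟩)
  neg_mem' := by
    rintro f ⟨P, hP, hf⟩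
    refine ⟨P, hP, ?_⟩
    rintro _ ⟨x, rfl⟩
    exact P.neg_mem (hf ⟨x, rfl⟩)

/-- Type synonym for the objects of the category `𝒞^all`: all `R`-modules. -/
structure CalkinAll (R : Type u) [CommRing R] : Type (u + 1) where
  /-- the underlying module -/
  of : ModuleCat.{u} R

namespace CalkinAll

variable {R : Type u} [CommRing R]

/-- Composition of classes of linear maps. -/
def comp {M N P : Type*} [AddCommGroup M] [Module R M] [AddCommGroup N] [Module R N]
    [AddCommGroup P] [Module R P] :
    ((M →ₗ[R] N) ⧸ finiteImageMaps R M N) → ((N →ₗ[R] P) ⧸ finiteImageMaps R N P) →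
      ((M →ₗ[R] P) ⧸ finiteImageMaps R M P) :=
  Quotient.map₂ (fun f g => g ∘ₗ f) (by
    intro f f' hf g g' hg
    replace hf : -f + f' ∈ finiteImageMaps R M N := QuotientAddGroup.leftRel_apply.1 hf
    replace hg : -g + g' ∈ finiteImageMaps R N P := QuotientAddGroup.leftRel_apply.1 hg
    refine QuotientAddGroup.leftRel_apply.2 ?_
    obtain ⟨A, hA, hfA⟩ := hf
    obtain ⟨B, hB, hgB⟩ := hg
    refine ⟨A.map g ⊔ B, (hA.map g).sup hB, ?_⟩
    rintro _ ⟨x, rfl⟩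
    have h1 : g ((-f + f') x) ∈ A.map g := ⟨_, hfA ⟨x, rfl⟩, rfl⟩
    have h2 : (-g + g') (f' x) ∈ B := hgB ⟨f' x, rfl⟩
    have h3 := Submodule.add_mem_sup h1 h2
    simpa using h3)

/-- The category `𝒞^all`: the objects are all `R`-modules, and `Hom(M, N)` is the group of linear
maps modulo those whose image is contained in a finitely generated submodule. -/
instance : Category (CalkinAll R) where
  Hom M N := (M.of →ₗ[R] N.of) ⧸ finiteImageMaps R M.of N.of
  id M := QuotientAddGroup.mk LinearMap.id
  comp f g := comp f g
  id_comp := by rintro _ _ ⟨f⟩; rfl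
  comp_id := by rintro _ _ ⟨f⟩; rfl
  assoc := by rintro _ _ _ _ ⟨f⟩ ⟨g⟩ ⟨h⟩; rfl

/-- The class in `𝒞^all` of a linear map. -/
def homMk {M N : CalkinAll R} (f : M.of →ₗ[R] N.of) : M ⟶ N :=
  (QuotientAddGroup.mk f : (M.of →ₗ[R] N.of) ⧸ finiteImageMaps R M.of N.of)

theorem homMk_id (M : CalkinAll R) : homMk (LinearMap.id : M.of →ₗ[R] M.of) = 𝟙 M := rfl

theorem homMk_comp {M N P : CalkinAll R} (f : M.of →ₗ[R] N.of) (g : N.of →ₗ[R] P.of) :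
    (homMk (g ∘ₗ f) : M ⟶ P) = (homMk f : M ⟶ N) ≫ (homMk g : N ⟶ P) := rfl

instance (M N : CalkinAll R) : AddCommGroup (M ⟶ N) :=
  inferInstanceAs (AddCommGroup ((M.of →ₗ[R] N.of) ⧸ finiteImageMaps R M.of N.of))

theorem homMk_add {M N : CalkinAll R} (f g : M.of →ₗ[R] N.of) :
    (homMk (f + g) : M ⟶ N) = homMk f + homMk g := rfl

theorem homMk_zero {M N : CalkinAll R} : (homMk 0 : M ⟶ N) = 0 := rfl

theorem homMk_surjective {M N : CalkinAll R} (f : M ⟶ N) : ∃ g, homMk g = f :=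
  QuotientAddGroup.mk_surjective f

theorem homMk_eq_iff {M N : CalkinAll R} (f g : M.of →ₗ[R] N.of) :
    (homMk f : M ⟶ N) = homMk g ↔ -f + g ∈ finiteImageMaps R M.of N.of :=
  QuotientAddGroup.eq

instance : Preadditive (CalkinAll R) where
  add_comp M N P f f' g := by
    obtain ⟨f, rfl⟩ := homMk_surjective f
    obtain ⟨f', rfl⟩ := homMk_surjective f'
    obtain ⟨g, rfl⟩ := homMk_surjective g
    rw [← homMk_add, ← homMk_comp, ← homMk_comp, ← homMk_comp, ← homMk_add, LinearMap.comp_add]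
  comp_add M N P f g g' := by
    obtain ⟨f, rfl⟩ := homMk_surjective f
    obtain ⟨g, rfl⟩ := homMk_surjective g
    obtain ⟨g', rfl⟩ := homMk_surjective g'
    rw [← homMk_add, ← homMk_comp, ← homMk_comp, ← homMk_comp, ← homMk_add, LinearMap.add_comp]

end CalkinAll

/-- The property, of an object of `𝒞^all`, of being a projective module. -/
def CalkinAll.isProjective (R : Type u) [CommRing R] : ObjectProperty (CalkinAll R) :=
  fun M => Module.Projective R M.of

/-- The category `𝒞`: the full subcategory of `𝒞^all` formed by the projective modules. -/
abbrev CalkinProj (R : Type u) [CommRing R] : Type (u + 1) :=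
  (CalkinAll.isProjective R).FullSubcategory

/-- The Calkin category of `R`: the idempotent completion of `𝒞`. -/
abbrev CalkinCategory (R : Type u) [CommRing R] : Type (u + 1) :=
  Karoubi (CalkinProj R)

instance (R : Type u) [CommRing R] : HasFiniteBiproducts (CalkinProj R) := by
  have h0 : HasZeroObject (CalkinProj R) := by
    have h : Module.Projective R PUnit.{u + 1} := inferInstance
    refine ⟨⟨⟨⟨ModuleCat.of R PUnit⟩, h⟩, ?_⟩⟩
    rw [IsZero.iff_id_eq_zero]
    ext
    have h' : (LinearMap.id : PUnit.{u + 1} →ₗ[R] PUnit.{u + 1}) = 0 :=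
      LinearMap.ext fun _ => rfl
    exact congrArg (CalkinAll.homMk (M := ⟨ModuleCat.of R PUnit⟩) (N := ⟨ModuleCat.of R PUnit⟩)) h'
  have h2 : HasBinaryBiproducts (CalkinProj R) := by
    refine ⟨fun X Y => ?_⟩
    have hX : Module.Projective R X.obj.of := X.property
    have hY : Module.Projective R Y.obj.of := Y.property
    have hZ : Module.Projective R (X.obj.of × Y.obj.of) := inferInstance
    let Z : CalkinProj R := ⟨⟨ModuleCat.of R (X.obj.of × Y.obj.of)⟩, hZ⟩
    let pX : Z.obj.of →ₗ[R] X.obj.of := LinearMap.fst R X.obj.of Y.obj.of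
    let pY : Z.obj.of →ₗ[R] Y.obj.of := LinearMap.snd R X.obj.of Y.obj.of
    let iX : X.obj.of →ₗ[R] Z.obj.of := LinearMap.inl R X.obj.of Y.obj.of
    let iY : Y.obj.of →ₗ[R] Z.obj.of := LinearMap.inr R X.obj.of Y.obj.of
    let P {A B : CalkinProj R} (f : A.obj.of →ₗ[R] B.obj.of) : A ⟶ B :=
      ObjectProperty.homMk (CalkinAll.homMk f)
    have hP {A B C : CalkinProj R} (f : A.obj.of →ₗ[R] B.obj.of) (g : B.obj.of →ₗ[R] C.obj.of) :
        (P f : A ⟶ B) ≫ (P g : B ⟶ C) = P (g ∘ₗ f) := rfl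
    have h1 (A : CalkinProj R) : (P LinearMap.id : A ⟶ A) = 𝟙 A := rfl
    have h0 (A B : CalkinProj R) : (P 0 : A ⟶ B) = 0 := rfl
    have hadd {A B : CalkinProj R} (f g : A.obj.of →ₗ[R] B.obj.of) :
        (P f : A ⟶ B) + P g = P (f + g) := rfl
    let b : BinaryBicone X Y :=
      { pt := Z
        fst := P pX
        snd := P pY
        inl := P iX
        inr := P iY
        inl_fst := by rw [hP, ← h1]; congr 1
        inl_snd := by rw [hP, ← h0]; congr 1
        inr_fst := by rw [hP, ← h0]; congr 1
        inr_snd := by rw [hP, ← h1]; congr 1 }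
    refine hasBinaryBiproduct_of_total b ?_
    change (P pX : Z ⟶ X) ≫ (P iX : X ⟶ Z) + (P pY : Z ⟶ Y) ≫ (P iY : Y ⟶ Z) = 𝟙 Z
    rw [hP, hP, hadd, ← h1]
    congr 1
    exact LinearMap.ext fun z => Prod.ext (add_zero z.1) (zero_add z.2)
  have := hasFiniteProducts_of_has_binary_and_terminal (C := CalkinProj R)
  exact HasFiniteBiproducts.of_hasFiniteProducts

/-- `K₋₁(R)`, defined as `K₀` of the Calkin category of `R`. -/
abbrev KMinusOne (R : Type u) [CommRing R] : Type (u + 1) :=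
  KZero (CalkinCategory R)

end Calkin

/-! ### Base change -/

section BaseChange

variable (R S : Type u) [CommRing R] [CommRing S] [Algebra R S]

theorem baseChange_mem_finiteImageMaps {M N : Type*} [AddCommGroup M] [Module R M]
    [AddCommGroup N] [Module R N] {f : M →ₗ[R] N} (hf : f ∈ finiteImageMaps R M N) :
    f.baseChange S ∈ finiteImageMaps S (S ⊗[R] M) (S ⊗[R] N) := by
  obtain ⟨P, ⟨t, rfl⟩, hP⟩ := hf
  classical
  refine ⟨(Submodule.span R (t : Set N)).baseChange S, ?_, ?_⟩
  · rw [Submodule.baseChange_span]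
    exact Submodule.fg_span (t.finite_toSet.image _)
  · rintro _ ⟨x, rfl⟩
    induction x using TensorProduct.induction_on with
    | zero => simp
    | tmul s m =>
      rw [LinearMap.baseChange_tmul]
      exact Submodule.tmul_mem_baseChange_of_mem s (hP ⟨m, rfl⟩)
    | add x y hx hy => rw [map_add]; exact Submodule.add_mem _ hx hy

/-- The functor `M ↦ S ⊗[R] M` on the categories `𝒞^all`. -/
def CalkinAll.baseChange : CalkinAll R ⥤ CalkinAll S where
  obj M := ⟨ModuleCat.of S (S ⊗[R] M.of)⟩
  map {M N} := QuotientAddGroup.map (finiteImageMaps R M.of N.of)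
    (finiteImageMaps S (S ⊗[R] M.of) (S ⊗[R] N.of))
    (LinearMap.baseChangeHom R S M.of N.of).toAddMonoidHom
    (fun _ hf => baseChange_mem_finiteImageMaps R S hf)
  map_id M := congrArg (CalkinAll.homMk (M := ⟨ModuleCat.of S (S ⊗[R] M.of)⟩)
    (N := ⟨ModuleCat.of S (S ⊗[R] M.of)⟩)) (LinearMap.baseChange_id (R := R) (A := S) (M := M.of))
  map_comp {M _ N} := by
    rintro ⟨f⟩ ⟨g⟩
    exact congrArg (CalkinAll.homMk (M := ⟨ModuleCat.of S (S ⊗[R] M.of)⟩)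
      (N := ⟨ModuleCat.of S (S ⊗[R] N.of)⟩)) (LinearMap.baseChange_comp (A := S) f g)

theorem CalkinAll.baseChange_map_homMk {M N : CalkinAll R} (f : M.of →ₗ[R] N.of) :
    (CalkinAll.baseChange R S).map (CalkinAll.homMk f) =
      CalkinAll.homMk (M := ⟨ModuleCat.of S (S ⊗[R] M.of)⟩)
        (N := ⟨ModuleCat.of S (S ⊗[R] N.of)⟩) (f.baseChange S) := rfl

instance : (CalkinAll.baseChange R S).Additive where
  map_add {M N f g} := map_add (QuotientAddGroup.map (finiteImageMaps R M.of N.of)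
    (finiteImageMaps S (S ⊗[R] M.of) (S ⊗[R] N.of))
    (LinearMap.baseChangeHom R S M.of N.of).toAddMonoidHom
    (fun _ hf => baseChange_mem_finiteImageMaps R S hf)) f g

theorem CalkinAll.isProjective_baseChange {M : CalkinAll R} (hM : isProjective R M) :
    isProjective S ((CalkinAll.baseChange R S).obj M) := by
  have : Module.Projective R M.of := hM
  have h : Module.Projective S (S ⊗[R] M.of) := inferInstance
  exact h

/-- The functor `M ↦ S ⊗[R] M` on the categories `𝒞` of projective modules. -/
def CalkinProj.baseChange : CalkinProj R ⥤ CalkinProj S :=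
  (CalkinAll.isProjective S).lift
    ((CalkinAll.isProjective R).ι ⋙ CalkinAll.baseChange R S)
    (fun M => CalkinAll.isProjective_baseChange R S M.property)

instance : (CalkinProj.baseChange R S).Additive :=
  inferInstanceAs (((CalkinAll.isProjective S).lift
    ((CalkinAll.isProjective R).ι ⋙ CalkinAll.baseChange R S) _).Additive)

/-- The functor `(M, p) ↦ (S ⊗[R] M, S ⊗[R] p)` on the Calkin categories. -/
def CalkinCategory.baseChange : CalkinCategory R ⥤ CalkinCategory S :=
  (functorExtension₂ (CalkinProj R) (CalkinProj S)).obj (CalkinProj.baseChange R S)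

instance : (CalkinCategory.baseChange R S).Additive where
  map_add {X Y f g} := by
    ext1
    exact (CalkinProj.baseChange R S).map_add (f := f.f) (g := g.f)

/-- The map `K₋₁(R) → K₋₁(S)` given by base change. -/
def KMinusOne.baseChange : KMinusOne R →+ KMinusOne S :=
  KZero.map (CalkinCategory.baseChange R S)

end BaseChange

/-! ### Nisnevich coverings -/

/-- The open subset `V(I) \ V(J)` of the closed subscheme `V(I) = Spec (R ⧸ I)` of `Spec R`. -/
def stratum (R : CommRingCat.{u}) (I J : Ideal R) : (Spec (CommRingCat.of (R ⧸ I))).Opens :=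
  Spec.map (CommRingCat.ofHom (Ideal.Quotient.mk I)) ⁻¹ᵁ
    ⟨(PrimeSpectrum.zeroLocus (J : Set R))ᶜ, (PrimeSpectrum.isClosed_zeroLocus _).isOpen_compl⟩

/-- The immersion of `V(I) \ V(J)`, with the scheme structure induced by `Spec (R ⧸ I)`,
into `Spec R`. -/
def stratumι (R : CommRingCat.{u}) (I J : Ideal R) : (stratum R I J).toScheme ⟶ Spec R :=
  (stratum R I J).ι ≫ Spec.map (CommRingCat.ofHom (Ideal.Quotient.mk I))

/-- A morphism `π : X ⟶ Spec R` is a Nisnevich covering if it is etale and there are closed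
subschemes `Spec R = F₀ ⊇ F₁ ⊇ … ⊇ Fₙ = ∅`, each defined by finitely many equations, such that
`π` admits a section over every `Fᵢ \ Fᵢ₊₁`. Here `Fᵢ = V(Iᵢ)`. -/
def IsNisnevichCovering {R : CommRingCat.{u}} {X : Scheme.{u}} (π : X ⟶ Spec R) : Prop :=
  Etale π ∧ ∃ (n : ℕ) (I : ℕ → Ideal R), I 0 = ⊥ ∧ I n = ⊤ ∧
    (∀ i ≤ n, (I i).FG) ∧
    (∀ i < n, I i ≤ I (i + 1)) ∧
    ∀ i < n, ∃ s : (stratum R (I i) (I (i + 1))).toScheme ⟶ X,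
      s ≫ π = stratumι R (I i) (I (i + 1))

end

/-! The obstruction is lifting an idempotent. Complementary idempotents and the Eilenberg swindle
show that every element of $K_{-1}(R)$ is the class of some $(A,p)$, and that this class is $0$ as
soon as $p$ lifts to an honest idempotent of $A$ (`kZeroMk_ofIdempotent`). Let $\varphi$ be any
linear lift of $p$. Since $\varphi^2-\varphi$ has image in a finitely generated module,
Cayley–Hamilton yields a monic $f$, divisible by $X^2-X$, with $f(\varphi)=0$
(`exists_monic_aeval_eq_zero_of_mem_finiteImageMaps`). If $e\in R[X]$ is idempotent modulo $f$ and
congruent to $X$ modulo $X^2-X$, then $e(\varphi)$ is the required lift.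

Such an $e$ comes from a coprime factorization $f=gh$ with $h(0)$ and $g(1)$ invertible
(`HasIdempotentSplitting.of_isCoprime`). For fixed degrees of monic factors, these factorizations
are classified by an étale $R$-algebra. Where the coefficients $c_j$ of $f$ vanish for $j<m$ and
$c_m$ is invertible, $f=X^m\cdot h$ is one of them. The corresponding strata exhaust
$\operatorname{Spec}R$ because $f$ is monic, so the product of the classifying algebras over all $m$
is a Nisnevich covering. Over a Henselian local ring, one of these algebras has a point in the
residue field, which lifts to $R$. -/

/-! ### Splitting polynomials by idempotents -/

namespace Polynomial

/-- `f` has an idempotent splitting if the idempotent `X` of `R[X] ⧸ (X ^ 2 - X)` lifts to an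
idempotent of `R[X] ⧸ (f)`; for this notion to be meaningful, `X ^ 2 - X` should divide `f`. -/
def HasIdempotentSplitting {R : Type*} [CommRing R] (f : Polynomial R) : Prop :=
  ∃ e : Polynomial R, f ∣ e ^ 2 - e ∧ X ^ 2 - X ∣ e - X

theorem HasIdempotentSplitting.map {R S : Type*} [CommRing R] [CommRing S] {f : Polynomial R}
    (hf : f.HasIdempotentSplitting) (φ : R →+* S) : (f.map φ).HasIdempotentSplitting := by
  obtain ⟨e, h₁, h₂⟩ := hf
  refine ⟨e.map φ, ?_, ?_⟩
  · simpa using _root_.map_dvd (mapRingHom φ) h₁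
  · simpa using _root_.map_dvd (mapRingHom φ) h₂

/-- Over a finite product of rings, a polynomial is the same as a family of polynomials, finiteness
bounding the degrees; so the witnesses and the quotients can be chosen componentwise. -/
theorem HasIdempotentSplitting.pi {ι : Type*} [Finite ι] {A : ι → Type*} [∀ i, CommRing (A i)]
    {f : Polynomial (∀ i, A i)}
    (hf : ∀ i, (f.map (Pi.evalRingHom A i)).HasIdempotentSplitting) :
    f.HasIdempotentSplitting := by
  choose e h₁ h₂ using hf
  choose a ha using h₁
  choose b hb using h₂
  have key (p q : Polynomial (∀ i, A i))
      (h : ∀ i, p.map (Pi.evalRingHom A i) = q.map (Pi.evalRingHom A i)) : p = q :=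
    (piEquiv A).injective (by ext1 i; exact h i)
  have surj (e : ∀ i, Polynomial (A i)) :
      ∃ E : Polynomial (∀ i, A i), ∀ i, E.map (Pi.evalRingHom A i) = e i :=
    ⟨(piEquiv A).symm e, fun i => congrFun ((piEquiv A).apply_symm_apply e) i⟩
  obtain ⟨E, hE⟩ := surj e
  obtain ⟨F, hF⟩ := surj a
  obtain ⟨G, hG⟩ := surj b
  exact ⟨E, ⟨F, key _ _ fun i => by simp [hE, hF, ha]⟩,
    ⟨G, key _ _ fun i => by simp [hE, hG, hb]⟩⟩

/-- If $ag+bh=1$, take $e=ag$: then $e^2-e=-ab\,gh$. As $f(0)=f(1)=0$, the unit conditions force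
$g(0)=0$ and $h(1)=0$, hence $e(0)=0$ and $e(1)=1$, so both $X$ and $X-1$ divide $e-X$. -/
theorem HasIdempotentSplitting.of_isCoprime {R : Type*} [CommRing R] {f g h : Polynomial R}
    (hf : X ^ 2 - X ∣ f) (hgh : f = g * h) (hc : IsCoprime g h)
    (h0 : IsUnit (h.eval 0)) (g1 : IsUnit (g.eval 1)) : f.HasIdempotentSplitting := by
  obtain ⟨k, hk⟩ := hf
  obtain ⟨a, b, hab⟩ := hc
  have f0 : f.eval 0 = 0 := by simp [hk]
  have f1 : f.eval 1 = 0 := by simp [hk]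
  rw [hgh, eval_mul] at f0 f1
  have g0 : g.eval 0 = 0 := (h0.mul_left_eq_zero).1 f0
  have h1 : h.eval 1 = 0 := (g1.mul_right_eq_zero).1 f1
  refine ⟨a * g, ⟨-(a * b), ?_⟩, ?_⟩
  · linear_combination (a * g) * hab + (a * b) * hgh
  · have e1 : (a * g).eval 1 = 1 := by
      have := congrArg (eval 1) hab
      simpa [h1] using this
    have d0 : X - C 0 ∣ a * g - X := by
      rw [dvd_iff_isRoot]; simp [g0]
    have d1 : X - C 1 ∣ a * g - X := by
      rw [dvd_iff_isRoot]; simp only [IsRoot.def, eval_sub, e1, eval_X, sub_self]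
    have hco : IsCoprime (X - C 0 : Polynomial R) (X - C 1) := ⟨1, -1, by simp⟩
    have : (X ^ 2 - X : Polynomial R) = (X - C 0) * (X - C 1) := by simp; ring
    rw [this]
    exact hco.mul_dvd d0 d1

theorem HasIdempotentSplitting.map_of_isCoprime {A B : Type*} [CommRing A] [CommRing B]
    {f g h : Polynomial A} (hf : X ^ 2 - X ∣ f) (hgh : f = g * h) (hc : IsCoprime g h)
    (φ : A →+* B) (h0 : IsUnit (φ (h.eval 0))) (g1 : IsUnit (φ (g.eval 1))) :
    (f.map φ).HasIdempotentSplitting := by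
  refine .of_isCoprime (g := g.map φ) (h := h.map φ) ?_ ?_ (hc.map (mapRingHom φ))
    (by simpa using h0) (by simpa using g1)
  · simpa using _root_.map_dvd (mapRingHom φ) hf
  · rw [← Polynomial.map_mul, hgh]

section Universal

variable {R : Type u} [CommRing R] {n : ℕ} (f : MonicDegreeEq R n) (m k : ℕ) (hn : n = m + k)

/-- The first factor of the universal coprime factorization. -/
noncomputable abbrev universalFstFactor :
    MonicDegreeEq (UniversalCoprimeFactorizationRing m k hn f) m :=
  (UniversalCoprimeFactorizationRing.homEquiv _ m k hn f (AlgHom.id R _)).1.1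

/-- The second factor of the universal coprime factorization. -/
noncomputable abbrev universalSndFactor :
    MonicDegreeEq (UniversalCoprimeFactorizationRing m k hn f) k :=
  (UniversalCoprimeFactorizationRing.homEquiv _ m k hn f (AlgHom.id R _)).1.2

/-- The étale `R`-algebra classifying the factorizations of `f` as a product `g * h` of coprime
monic polynomials of degrees `m` and `k` such that `h(0)` and `g(1)` are invertible. -/
abbrev SplittingFactorizationRing : Type u :=
  Localization.Away ((universalSndFactor f m k hn).1.eval 0 *
    (universalFstFactor f m k hn).1.eval 1)

theorem hasIdempotentSplitting_splittingFactorizationRing (hf : X ^ 2 - X ∣ f.1) :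
    (f.1.map (algebraMap R (SplittingFactorizationRing f m k hn))).HasIdempotentSplitting := by
  obtain ⟨h₁, h₂⟩ :=
    (UniversalCoprimeFactorizationRing.homEquiv _ m k hn f (AlgHom.id R _)).2
  have hu := IsLocalization.Away.algebraMap_isUnit (S := SplittingFactorizationRing f m k hn)
    ((universalSndFactor f m k hn).1.eval 0 * (universalFstFactor f m k hn).1.eval 1)
  rw [map_mul, IsUnit.mul_iff] at hu
  have key := HasIdempotentSplitting.map_of_isCoprime (by
    simpa using _root_.map_dvd (mapRingHom (algebraMap R
      (UniversalCoprimeFactorizationRing m k hn f))) hf) h₁.symm h₂ _ hu.1 hu.2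
  rwa [Polynomial.map_map, ← IsScalarTower.algebraMap_eq] at key

/-- A coprime factorization in `A` with the required invertibility yields an `A`-point. -/
theorem nonempty_splittingFactorizationRing_algHom {A : Type u} [CommRing A] [Algebra R A]
    (g : MonicDegreeEq A m) (h : MonicDegreeEq A k)
    (hgh : g.1 * h.1 = f.1.map (algebraMap R A)) (hc : IsCoprime g.1 h.1)
    (h0 : IsUnit (h.1.eval 0)) (g1 : IsUnit (g.1.eval 1)) :
    Nonempty (SplittingFactorizationRing f m k hn →ₐ[R] A) := by
  let φ := (UniversalCoprimeFactorizationRing.homEquiv A m k hn f).symm ⟨(g, h), hgh, hc⟩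
  have hφ : UniversalCoprimeFactorizationRing.homEquiv A m k hn f
      (φ.comp (AlgHom.id R _)) = ⟨(g, h), hgh, hc⟩ := by simp [φ]
  have e1 : (universalFstFactor f m k hn).map φ = g := by
    rw [← UniversalCoprimeFactorizationRing.homEquiv_comp_fst, hφ]
  have e2 : (universalSndFactor f m k hn).map φ = h := by
    rw [← UniversalCoprimeFactorizationRing.homEquiv_comp_snd, hφ]
  refine ⟨IsLocalization.Away.liftAlgHom (f := φ) ((universalSndFactor f m k hn).1.eval 0 *
    (universalFstFactor f m k hn).1.eval 1) ?_⟩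
  rw [← e1] at g1
  rw [← e2] at h0
  rw [map_mul]
  refine IsUnit.mul ?_ ?_
  · convert h0
    rw [MonicDegreeEq.map_coe, eval_zero_map]; rfl
  · convert g1
    rw [MonicDegreeEq.map_coe, eval_one_map]; rfl

/-- If the first `m` coefficients of `f` vanish in `A` and the next one is invertible, then
`f = X ^ m * h` with `h(0)` invertible. -/
theorem nonempty_splittingFactorizationRing_algHom_of_coeff {A : Type u} [CommRing A] [Algebra R A]
    (h0 : ∀ i < m, algebraMap R A (f.1.coeff i) = 0) (hm : IsUnit (algebraMap R A (f.1.coeff m))) :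
    Nonempty (SplittingFactorizationRing f m k hn →ₐ[R] A) := by
  obtain ⟨h, hh⟩ := X_pow_dvd_iff.2
    (show ∀ i < m, (f.1.map (algebraMap R A)).coeff i = 0 by simpa using h0)
  have hcoeff (j : ℕ) : h.coeff j = algebraMap R A (f.1.coeff (j + m)) := by
    rw [← coeff_map, hh, coeff_X_pow_mul]
  have hc : IsUnit (h.eval 0) := by
    rwa [← coeff_zero_eq_eval_zero, hcoeff, zero_add]
  refine nonempty_splittingFactorizationRing_algHom f m k hn
    ⟨X ^ m, by simp, fun i hi => by simp [coeff_X_pow, hi.ne']⟩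
    ⟨h, by rw [hcoeff, add_comm, ← hn, f.2.1, map_one],
      fun i hi => by rw [hcoeff, f.2.2 _ (by omega), map_zero]⟩ hh.symm ?_ hc (by simp)
  -- $X$ and $h$ are coprime: $h=X\cdot$`h.divX`$\,+\,h(0)$ and $h(0)$ has inverse $v$.
  refine IsCoprime.pow_left ?_
  obtain ⟨v, hv⟩ := hc.exists_right_inv
  refine ⟨-C v * h.divX, C v, ?_⟩
  have e1 : C v * C (h.eval 0) = 1 := by rw [← C_mul, mul_comm, hv, C_1]
  have e2 := X_mul_divX_add h
  rw [coeff_zero_eq_eval_zero] at e2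
  linear_combination e1 - C v * e2

end Universal

end Polynomial

/-! ### Étale algebras over Henselian local rings -/

-- Near the point $\ker\varphi$, the algebra is standard étale, so the residue field point is a
-- simple root of a monic polynomial at which a second polynomial is nonzero. Hensel's lemma lifts
-- the root, and the second condition persists because $R$ is local.
open IsLocalRing in
theorem HenselianLocalRing.exists_algHom_of_etale {R S : Type u} [CommRing R]
    [HenselianLocalRing R] [CommRing S] [Algebra R S] [Algebra.Etale R S]
    (φ : S →ₐ[R] ResidueField R) : Nonempty (S →ₐ[R] R) := by
  have : (RingHom.ker φ).IsPrime := RingHom.ker_isPrime φ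
  obtain ⟨f, hf, hS⟩ :=
    Algebra.IsEtaleAt.exists_isStandardEtale (R := R) (RingHom.ker φ)
  obtain ⟨P⟩ := hS.nonempty_standardEtalePresentation
  let φ' : Localization.Away f →ₐ[R] ResidueField R :=
    IsLocalization.Away.liftAlgHom (f := φ) f (IsUnit.mk0 _ hf)
  have hx : P.HasMap (φ' P.x) := P.hasMap.map φ'
  have lift : ∀ f : Polynomial R, f.Monic → ∀ a₀ : ResidueField R, Polynomial.aeval a₀ f = 0 →
      Polynomial.aeval a₀ (Polynomial.derivative f) ≠ 0 →
        ∃ a : R, f.IsRoot a ∧ residue R a = a₀ :=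
    ((HenselianLocalRing.TFAE R).out 0 1).1 ‹_›
  obtain ⟨a, ha, ha'⟩ := lift P.f P.monic_f _ hx.1
    hx.isUnit_derivative_f.ne_zero
  have hax : P.HasMap a := by
    refine ⟨ha, ?_⟩
    have h := hx.2
    rw [← ha', ← ResidueField.algebraMap_eq, Polynomial.aeval_algebraMap_apply] at h
    exact isUnit_of_map_unit (residue R) _ h
  exact ⟨((P.lift a hax).comp P.equivRing.toAlgHom).comp
    (IsScalarTower.toAlgHom R S (Localization.Away f))⟩

/-! ### Nisnevich coverings from algebra maps -/

namespace AlgebraicGeometry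

/-- The ring homomorphism `R → Γ(X, ⊤)` corresponding to a morphism `X ⟶ Spec R`. -/
noncomputable def Scheme.Hom.globalRingHom {R : CommRingCat.{u}} {X : Scheme.{u}}
    (f : X ⟶ Spec R) : R ⟶ Γ(X, ⊤) :=
  (Scheme.ΓSpecIso R).inv ≫ f.appTop

theorem Scheme.Hom.toSpecΓ_globalRingHom {R : CommRingCat.{u}} {X : Scheme.{u}}
    (f : X ⟶ Spec R) : X.toSpecΓ ≫ Spec.map (globalRingHom f) = f := by
  rw [globalRingHom, Spec.map_comp, ← Category.assoc, ← Scheme.toSpecΓ_naturality,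
    Category.assoc, toSpecΓ_SpecMap_ΓSpecIso_inv, Category.comp_id]

theorem Scheme.Hom.globalRingHom_comp_specMap {R S : CommRingCat.{u}} {X : Scheme.{u}}
    (f : X ⟶ Spec S) (φ : R ⟶ S) :
    globalRingHom (f ≫ Spec.map φ) = φ ≫ globalRingHom f := by
  simp [globalRingHom, Scheme.ΓSpecIso_inv_naturality_assoc]

/-- Lifts of `f : X ⟶ Spec R` to `Spec S` are given by factorizations of `R → Γ(X, ⊤)`. -/
theorem Scheme.Hom.exists_lift_of_globalRingHom {R S : CommRingCat.{u}} {X : Scheme.{u}}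
    (f : X ⟶ Spec R) (φ : R ⟶ S) (ψ : S ⟶ Γ(X, ⊤)) (h : φ ≫ ψ = globalRingHom f) :
    ∃ s : X ⟶ Spec S, s ≫ Spec.map φ = f :=
  ⟨X.toSpecΓ ≫ Spec.map ψ, by
    rw [Category.assoc, ← Spec.map_comp, h, toSpecΓ_globalRingHom]⟩

/-- The basic open set of $r$ is all of $X$, and a section invertible in every stalk is invertible.
-/
theorem Scheme.Hom.isUnit_globalRingHom {R : CommRingCat.{u}} {X : Scheme.{u}}
    (f : X ⟶ Spec R) (r : R) (h : ∀ x : X, r ∉ (f x).asIdeal) :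
    IsUnit ((globalRingHom f).hom r) := by
  have hb (x : X) : x ∈ X.basicOpen ((globalRingHom f).hom r) := by
    rw [← Scheme.toSpecΓ_preimage_basicOpen]
    have hx := h x
    rw [← toSpecΓ_globalRingHom f] at hx
    exact hx
  exact RingedSpace.isUnit_of_isUnit_germ X.toRingedSpace ⊤ _ fun x _ =>
    (Scheme.mem_basicOpen_top X _ x).1 (hb x)

end AlgebraicGeometry

theorem globalRingHom_stratumι_eq_zero (R : CommRingCat.{u}) {I J : Ideal R} {r : R}
    (hr : r ∈ I) : (Scheme.Hom.globalRingHom (stratumι R I J)).hom r = 0 := by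
  rw [stratumι, Scheme.Hom.globalRingHom_comp_specMap]
  have : Ideal.Quotient.mk I r = 0 := Ideal.Quotient.eq_zero_iff_mem.2 hr
  simp [this]

/-- A prime containing both $I$ and $r$ would contain $J$, but the stratum avoids $V(J)$. -/
theorem isUnit_globalRingHom_stratumι (R : CommRingCat.{u}) {I J : Ideal R} {r : R}
    (hJ : J ≤ I ⊔ Ideal.span {r}) :
    IsUnit ((Scheme.Hom.globalRingHom (stratumι R I J)).hom r) := by
  refine Scheme.Hom.isUnit_globalRingHom _ _ fun x hx => ?_
  have hI : I ≤ (stratumι R I J x).asIdeal := fun a ha => by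
    change Ideal.Quotient.mk I a ∈ x.1.asIdeal
    rw [Ideal.Quotient.eq_zero_iff_mem.2 ha]
    exact zero_mem _
  exact x.2 (hJ.trans (sup_le hI ((Ideal.span_singleton_le_iff_mem _).2 hx)))

/-- A criterion for Nisnevich coverings in terms of algebras: it suffices to have algebra maps
into the algebras in which a given sequence `c` begins with zeros followed by a unit. -/
theorem isNisnevichCovering_of_nonempty_algHom {R S : Type u} [CommRing R] [CommRing S]
    [Algebra R S] [Algebra.Etale R S] (n : ℕ) (c : ℕ → R) (hc : c n = 1)
    (h : ∀ i ≤ n, ∀ (A : Type u) [CommRing A] [Algebra R A],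
      (∀ j < i, algebraMap R A (c j) = 0) → IsUnit (algebraMap R A (c i)) →
        Nonempty (S →ₐ[R] A)) :
    IsNisnevichCovering (Spec.map (CommRingCat.ofHom (algebraMap R S))) := by
  -- $I_i=(c_0,\dots,c_{i-1})$, so the $i$-th stratum is the locus in $V(I_i)$ where $c_i\neq0$. The
  -- chain has length $n+1$, since $c_n=1$ first enters in $I_{n+1}$.
  let I (i : ℕ) : Ideal R := Ideal.span (c '' Set.Iio i)
  refine ⟨?_, n + 1, I, by simp [I], ?_, fun i _ => ?_, fun i _ => ?_, fun i hi => ?_⟩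
  · rw [HasRingHomProperty.Spec_iff (P := @Etale)]
    simpa [RingHom.etale_algebraMap]
  · exact (Ideal.eq_top_iff_one _).2 (Ideal.subset_span ⟨n, by simp, hc⟩)
  · exact Submodule.fg_span ((Set.finite_Iio i).image c)
  · exact Ideal.span_mono (Set.image_mono (Set.Iio_subset_Iio (Nat.le_succ i)))
  · let X := (stratum (CommRingCat.of R) (I i) (I (i + 1))).toScheme
    let ρ := Scheme.Hom.globalRingHom (stratumι (CommRingCat.of R) (I i) (I (i + 1)))
    -- Maps to an affine scheme depend only on global functions, so the hypothesis is applied to the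
    -- ring $\Gamma(X,\top)$.
    let : Algebra R Γ(X, ⊤) := ρ.hom.toAlgebra
    obtain ⟨ψ⟩ := h i (Nat.lt_succ_iff.1 hi) Γ(X, ⊤)
      (fun j hj => globalRingHom_stratumι_eq_zero (CommRingCat.of R)
        (Ideal.subset_span ⟨j, hj, rfl⟩))
      (isUnit_globalRingHom_stratumι (CommRingCat.of R) (by
        rw [Ideal.span_le]
        rintro _ ⟨j, hj, rfl⟩
        obtain hj | rfl := (Nat.lt_succ_iff.1 hj).lt_or_eq
        · exact Ideal.mem_sup_left (Ideal.subset_span ⟨j, hj, rfl⟩)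
        · exact Ideal.mem_sup_right (Ideal.mem_span_singleton_self _)))
    refine Scheme.Hom.exists_lift_of_globalRingHom _ _
      (CommRingCat.ofHom (R := S) (S := Γ(X, ⊤)) ψ.toRingHom) ?_
    ext r
    exact ψ.commutes r

/-! ### Monic polynomials annihilating an endomorphism that is idempotent up to finite image -/

theorem LinearMap.comp_aeval_of_comp_eq {R M N : Type*} [CommRing R] [AddCommGroup M] [Module R M]
    [AddCommGroup N] [Module R N] {a : Module.End R M} {b : Module.End R N} {j : M →ₗ[R] N}
    (h : j ∘ₗ a = b ∘ₗ j) (p : Polynomial R) :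
    j ∘ₗ Polynomial.aeval a p = Polynomial.aeval b p ∘ₗ j := by
  induction p using Polynomial.induction_on' with
  | add p q hp hq => rw [map_add, map_add, LinearMap.comp_add, LinearMap.add_comp, hp, hq]
  | monomial n r =>
    rw [Polynomial.aeval_monomial, Polynomial.aeval_monomial, ← Algebra.smul_def,
      ← Algebra.smul_def, LinearMap.comp_smul, LinearMap.smul_comp]
    congr 1
    induction n with
    | zero => rfl
    | succ n ih =>
      rw [pow_succ, pow_succ, Module.End.mul_eq_comp, Module.End.mul_eq_comp,
        ← LinearMap.comp_assoc, ih, LinearMap.comp_assoc, h, LinearMap.comp_assoc]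

-- Let $q=\varphi^2-\varphi$ have image in $P$ finitely generated. Cayley–Hamilton gives a monic
-- $\chi$ with $\chi(q)=0$ on $P$, hence $\chi(q)\,q=0$ on $M$. Take $f=(X^2-X)\,\chi(X^2-X)$.
open Polynomial in
theorem exists_monic_aeval_eq_zero_of_mem_finiteImageMaps {R M : Type*} [CommRing R]
    [AddCommGroup M] [Module R M] {φ : Module.End R M}
    (hφ : φ ^ 2 - φ ∈ finiteImageMaps R M M) :
    ∃ f : Polynomial R, f.Monic ∧ X ^ 2 - X ∣ f ∧ aeval φ f = 0 := by
  obtain ⟨P, hP, hq⟩ := hφ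
  set q := φ ^ 2 - φ with hq'
  have : Module.Finite R P := Module.Finite.iff_fg.2 hP
  have hmem (x : M) : q x ∈ P := hq ⟨x, rfl⟩
  let qP : Module.End R P := (q ∘ₗ P.subtype).codRestrict P fun x => hmem x
  obtain ⟨χ, hχ, hχ0⟩ := LinearMap.exists_monic_and_aeval_eq_zero R qP
  have hcomp : P.subtype ∘ₗ qP = q ∘ₗ P.subtype := rfl
  have key := LinearMap.comp_aeval_of_comp_eq hcomp χ
  rw [hχ0, LinearMap.comp_zero] at key
  have hmonic : (X ^ 2 - X : Polynomial R).Monic :=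
    monic_X_pow_sub (degree_X_le.trans_lt (by exact_mod_cast one_lt_two))
  refine ⟨(X ^ 2 - X) * χ.comp (X ^ 2 - X), hmonic.mul ?_, dvd_mul_right _ _, ?_⟩
  · nontriviality R
    refine hχ.comp hmonic ?_
    rw [natDegree_sub_eq_left_of_natDegree_lt (by simp)]
    simp
  · have hX : aeval φ (X ^ 2 - X : Polynomial R) = q := by simp [hq']
    rw [mul_comm, map_mul, aeval_comp, hX]
    ext x
    exact (LinearMap.congr_fun key ⟨q x, hmem x⟩).symm

theorem aeval_baseChange_eq_zero {R M : Type*} (S : Type*) [CommRing R] [CommRing S] [Algebra R S]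
    [AddCommGroup M] [Module R M] {φ : Module.End R M} {f : Polynomial R}
    (h : Polynomial.aeval φ f = 0) :
    Polynomial.aeval (φ.baseChange S : Module.End S (S ⊗[R] M)) (f.map (algebraMap R S)) = 0 := by
  rw [Polynomial.aeval_map_algebraMap]
  have := Polynomial.aeval_algHom_apply (Module.End.baseChangeHom R S M) φ f
  rwa [h, map_zero] at this

/-! ### The group `K₀` -/

section

variable {A : Type*} [Category* A] [Preadditive A] [HasFiniteBiproducts A]

theorem KZero.mk_pt {X Y : A} (b : BinaryBicone X Y) (hb : b.IsBilimit) :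
    KZero.mk b.pt = KZero.mk X + KZero.mk Y := by
  rw [← sub_eq_zero, ← sub_sub]
  exact (QuotientAddGroup.eq_zero_iff _).2 (AddSubgroup.subset_closure ⟨X, Y, b, ⟨hb⟩, rfl⟩)

attribute [local instance] hasBinaryBiproducts_of_finite_biproducts

open ZeroObject

theorem KZero.mk_biprod (X Y : A) : KZero.mk (X ⊞ Y) = KZero.mk X + KZero.mk Y :=
  KZero.mk_pt (BinaryBiproduct.bicone X Y) (BinaryBiproduct.isBilimit X Y)

theorem KZero.mk_zero : KZero.mk (0 : A) = 0 := by
  let b : BinaryBicone (0 : A) (0 : A) := ⟨0, 0, 0, 0, 0, by simp, by simp, by simp, by simp⟩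
  have h := KZero.mk_pt b (isBinaryBilimitOfTotal b ((isZero_zero A).eq_of_src _ _))
  change KZero.mk (0 : A) = KZero.mk (0 : A) + KZero.mk (0 : A) at h
  simpa using h

/-- If every class has a negative which is a class, then every element of `K₀` is a class. -/
theorem KZero.mk_surjective (h : ∀ X : A, ∃ Y : A, KZero.mk X + KZero.mk Y = 0) :
    Function.Surjective (KZero.mk : A → KZero A) := by
  rintro ⟨x⟩
  induction x using FreeAbelianGroup.induction_on with
  | zero => exact ⟨0, KZero.mk_zero⟩
  | of X => exact ⟨X, rfl⟩
  | neg X _ =>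
    obtain ⟨Y, hY⟩ := h X
    exact ⟨Y, (neg_eq_of_add_eq_zero_right hY).symm⟩
  | add x y hx hy =>
    obtain ⟨X, hX⟩ := hx
    obtain ⟨Y, hY⟩ := hy
    exact ⟨X ⊞ Y, (KZero.mk_biprod X Y).trans (congrArg₂ (· + ·) hX hY)⟩

theorem KZero.map_mk {B : Type*} [Category* B] [Preadditive B] [HasFiniteBiproducts B]
    (F : A ⥤ B) [F.Additive] (X : A) : KZero.map F (KZero.mk X) = KZero.mk (F.obj X) := by
  change (QuotientAddGroup.mk _ : FreeAbelianGroup B ⧸ KZeroRelations B) = QuotientAddGroup.mk _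
  rw [FreeAbelianGroup.map_of_apply]

end

/-! ### Classes in the Calkin category -/

namespace CalkinProj

variable {R : Type u} [CommRing R]

/-- The morphism in `𝒞` given by a linear map. -/
def homMk {A B : CalkinProj R} (f : A.obj.of →ₗ[R] B.obj.of) : A ⟶ B :=
  ObjectProperty.homMk (CalkinAll.homMk f)

theorem homMk_surjective {A B : CalkinProj R} (f : A ⟶ B) :
    ∃ g : A.obj.of →ₗ[R] B.obj.of, homMk g = f := by
  obtain ⟨g, hg⟩ := CalkinAll.homMk_surjective f.hom
  exact ⟨g, congrArg ObjectProperty.homMk hg⟩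

theorem homMk_comp {A B C : CalkinProj R} (f : A.obj.of →ₗ[R] B.obj.of)
    (g : B.obj.of →ₗ[R] C.obj.of) : (homMk (g ∘ₗ f) : A ⟶ C) = homMk f ≫ homMk g := rfl

theorem homMk_eq_iff {A B : CalkinProj R} (f g : A.obj.of →ₗ[R] B.obj.of) :
    (homMk f : A ⟶ B) = homMk g ↔ -f + g ∈ finiteImageMaps R A.obj.of B.obj.of :=
  ⟨fun h => (CalkinAll.homMk_eq_iff f g).1 (congrArg (fun k : A ⟶ B => k.hom) h),
    fun h => congrArg ObjectProperty.homMk ((CalkinAll.homMk_eq_iff f g).2 h)⟩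

end CalkinProj

namespace CalkinCategory

variable {R : Type u} [CommRing R]

/-- The object of the Calkin category given by an idempotent endomorphism. -/
def ofIdempotent (A : CalkinProj R) (π : Module.End R A.obj.of) (hπ : IsIdempotentElem π) :
    CalkinCategory R where
  X := A
  p := CalkinProj.homMk π
  idem := congrArg CalkinProj.homMk hπ

/-- The morphism in the Calkin category given by a linear map compatible with idempotents. -/
def homOfLinearMap {A B : CalkinProj R} {π : Module.End R A.obj.of} {hπ : IsIdempotentElem π}
    {ρ : Module.End R B.obj.of} {hρ : IsIdempotentElem ρ} (f : A.obj.of →ₗ[R] B.obj.of)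
    (hf : ρ ∘ₗ f ∘ₗ π = f) : ofIdempotent A π hπ ⟶ ofIdempotent B ρ hρ where
  f := CalkinProj.homMk f
  comm := congrArg CalkinProj.homMk hf

/-- The class of an honest idempotent vanishes, by the Eilenberg swindle. -/
theorem kZeroMk_ofIdempotent (A : CalkinProj R) (π : Module.End R A.obj.of)
    (hπ : IsIdempotentElem π) : KZero.mk (ofIdempotent A π hπ) = 0 := by
  have hA : Module.Projective R A.obj.of := A.property
  classical
  have hB : Module.Projective R (ℕ →₀ A.obj.of) :=
    .of_equiv (finsuppLequivDFinsupp (ι := ℕ) (M := A.obj.of) R).symm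
  let B : CalkinProj R := ⟨⟨ModuleCat.of R (ℕ →₀ A.obj.of)⟩, hB⟩
  let ρ : Module.End R (ℕ →₀ A.obj.of) := Finsupp.mapRange.linearMap π
  have hπ' (x : A.obj.of) : π (π x) = π x := LinearMap.congr_fun hπ x
  have hρ : IsIdempotentElem ρ := by
    ext i x : 2
    simp [ρ, hπ']
  have hzero (x : ℕ →₀ A.obj.of) : Finsupp.mapDomain Nat.succ x 0 = 0 :=
    Finsupp.mapDomain_of_notMem_range x 0 (by simp)
  have hsucc (x : ℕ →₀ A.obj.of) (i : ℕ) : Finsupp.mapDomain Nat.succ x (i + 1) = x i :=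
    Finsupp.mapDomain_apply Nat.succ_injective x i
  -- Splitting off coordinate $0$ and shifting the others identifies $A^{(\mathbb N)}$ with $A\oplus
  -- A^{(\mathbb N)}$; inserting $\pi$ or $\rho$ makes these maps morphisms between the images of
  -- the idempotents.
  let fst : (ℕ →₀ A.obj.of) →ₗ[R] A.obj.of := π ∘ₗ Finsupp.lapply 0
  let snd : (ℕ →₀ A.obj.of) →ₗ[R] (ℕ →₀ A.obj.of) :=
    ρ ∘ₗ Finsupp.lcomapDomain Nat.succ Nat.succ_injective
  let inl : A.obj.of →ₗ[R] (ℕ →₀ A.obj.of) := Finsupp.lsingle 0 ∘ₗ π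
  let inr : (ℕ →₀ A.obj.of) →ₗ[R] (ℕ →₀ A.obj.of) := Finsupp.lmapDomain A.obj.of R Nat.succ ∘ₗ ρ
  have hfst (x : ℕ →₀ A.obj.of) : fst x = π (x 0) := rfl
  have hsnd (x : ℕ →₀ A.obj.of) (i : ℕ) : snd x i = π (x (i + 1)) := rfl
  have hinl0 (x : A.obj.of) : inl x 0 = π x := by simp [inl]
  have hinl (x : A.obj.of) (i : ℕ) : inl x (i + 1) = 0 := by simp [inl]
  have hinr0 (x : ℕ →₀ A.obj.of) : inr x 0 = 0 := hzero _
  have hinr (x : ℕ →₀ A.obj.of) (i : ℕ) : inr x (i + 1) = π (x i) := hsucc _ _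
  have hρ' (x : ℕ →₀ A.obj.of) (i : ℕ) : ρ x i = π (x i) := rfl
  clear_value fst snd inl inr ρ
  let b : BinaryBicone (ofIdempotent A π hπ) (ofIdempotent B ρ hρ) :=
    { pt := ofIdempotent B ρ hρ
      fst := homOfLinearMap fst (LinearMap.ext fun x => by simp [hfst, hρ', hπ'])
      snd := homOfLinearMap snd (LinearMap.ext fun x => Finsupp.ext fun i => by
        simp [hsnd, hρ', hπ'])
      inl := homOfLinearMap inl (LinearMap.ext fun x => Finsupp.ext fun i => by
        cases i <;> simp [hinl0, hinl, hρ', hπ'])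
      inr := homOfLinearMap inr (LinearMap.ext fun x => Finsupp.ext fun i => by
        cases i <;> simp [hinr0, hinr, hρ', hπ'])
      inl_fst := Karoubi.Hom.ext (congrArg CalkinProj.homMk
        (show fst ∘ₗ inl = π from LinearMap.ext fun x => by simp [hfst, hinl0, hπ']))
      inl_snd := Karoubi.Hom.ext (congrArg CalkinProj.homMk
        (show snd ∘ₗ inl = 0 from LinearMap.ext fun x => Finsupp.ext fun i => by
          simp [hsnd, hinl]))
      inr_fst := Karoubi.Hom.ext (congrArg CalkinProj.homMk
        (show fst ∘ₗ inr = 0 from LinearMap.ext fun x => by simp [hfst, hinr0]))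
      inr_snd := Karoubi.Hom.ext (congrArg CalkinProj.homMk
        (show snd ∘ₗ inr = ρ from LinearMap.ext fun x => Finsupp.ext fun i => by
          simp [hsnd, hinr, hρ', hπ'])) }
  have hb : b.IsBilimit := isBinaryBilimitOfTotal b (Karoubi.Hom.ext (congrArg CalkinProj.homMk
    (show inl ∘ₗ fst + inr ∘ₗ snd = ρ from LinearMap.ext fun x => Finsupp.ext fun i => by
      cases i <;> simp [hfst, hsnd, hinl0, hinl, hinr0, hinr, hρ', hπ'])))
  -- The swindle: $[B,\rho]=[A,\pi]+[B,\rho]$.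
  have h := KZero.mk_pt b hb
  change KZero.mk (ofIdempotent B ρ hρ) = _ at h
  simpa using h

/-- The class of an object `(A, p)` vanishes if `p` lifts to an honest idempotent. -/
theorem kZeroMk_eq_zero_of_isIdempotentElem {A : CalkinProj R} {p : A ⟶ A} (hp : p ≫ p = p)
    (π : Module.End R A.obj.of) (hπ : IsIdempotentElem π) (h : CalkinProj.homMk π = p) :
    KZero.mk (⟨A, p, hp⟩ : CalkinCategory R) = 0 := by
  subst h
  exact kZeroMk_ofIdempotent A π hπ

theorem sq_sub_self_mem_finiteImageMaps (X : CalkinCategory R) (φ : Module.End R X.X.obj.of)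
    (h : CalkinProj.homMk φ = X.p) : φ ^ 2 - φ ∈ finiteImageMaps R X.X.obj.of X.X.obj.of := by
  have hp := X.idem
  rw [← h, ← CalkinProj.homMk_comp, eq_comm, CalkinProj.homMk_eq_iff] at hp
  rwa [sub_eq_neg_add, sq]

open Polynomial in
/-- The class of an object `(A, p)` vanishes if `p` lifts to an endomorphism annihilated by a
polynomial with an idempotent splitting. -/
theorem kZeroMk_eq_zero_of_hasIdempotentSplitting (X : CalkinCategory R)
    (φ : Module.End R X.X.obj.of) (h : CalkinProj.homMk φ = X.p) {f : Polynomial R}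
    (hf : aeval φ f = 0) (hs : f.HasIdempotentSplitting) : KZero.mk X = 0 := by
  obtain ⟨e, ⟨a, ha⟩, ⟨b, hb⟩⟩ := hs
  refine kZeroMk_eq_zero_of_isIdempotentElem X.idem (aeval φ e) ?_ ?_
  · have := congrArg (aeval φ) ha
    rw [map_mul, hf, zero_mul, map_sub, map_pow, sub_eq_zero, sq] at this
    exact this
  -- $e(\varphi)-\varphi=(\varphi^2-\varphi)\,b(\varphi)$ has its image inside that of
  -- $\varphi^2-\varphi$, so $e(\varphi)$ still represents $p$.
  · rw [← h, eq_comm, CalkinProj.homMk_eq_iff]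
    obtain ⟨P, hP, hq⟩ := sq_sub_self_mem_finiteImageMaps X φ h
    have := congrArg (aeval φ) hb
    rw [map_sub, aeval_X, sub_eq_neg_add, map_mul, map_sub, map_pow, aeval_X] at this
    rw [this]
    exact ⟨P, hP, (LinearMap.range_comp_le_range _ _).trans hq⟩

/-- The complement of $(A,p)$ is $(A,1-p)$: their sum is $(A,1)$, whose class vanishes by the
swindle. -/
theorem exists_kZeroMk_add_eq_zero (X : CalkinCategory R) :
    ∃ Y : CalkinCategory R, KZero.mk X + KZero.mk Y = 0 := by
  let Z : CalkinCategory R := ofIdempotent X.X 1 IsIdempotentElem.one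
  let Y : CalkinCategory R := ⟨X.X, 𝟙 X.X - X.p, by simp [X.idem]⟩
  let b : BinaryBicone X Y :=
    { pt := Z
      fst := ⟨X.p, (Category.id_comp _).trans X.idem⟩
      snd := ⟨𝟙 X.X - X.p, (Category.id_comp _).trans Y.idem⟩
      inl := ⟨X.p, by
        change X.p ≫ X.p ≫ 𝟙 X.X = X.p
        rw [Category.comp_id, X.idem]⟩
      inr := ⟨𝟙 X.X - X.p, by
        change (𝟙 X.X - X.p) ≫ (𝟙 X.X - X.p) ≫ 𝟙 X.X = 𝟙 X.X - X.p
        rw [Category.comp_id]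
        exact Y.idem⟩
      inl_fst := Karoubi.Hom.ext X.idem
      inl_snd := Karoubi.Hom.ext (by
        change X.p ≫ (𝟙 X.X - X.p) = 0
        simp [X.idem])
      inr_fst := Karoubi.Hom.ext (by
        change (𝟙 X.X - X.p) ≫ X.p = 0
        simp [X.idem])
      inr_snd := Karoubi.Hom.ext Y.idem }
  have hb : b.IsBilimit := isBinaryBilimitOfTotal b (Karoubi.Hom.ext (by
    change X.p ≫ X.p + (𝟙 X.X - X.p) ≫ (𝟙 X.X - X.p) = 𝟙 X.X
    simp [X.idem]))
  exact ⟨Y, (KZero.mk_pt b hb).symm.trans (kZeroMk_ofIdempotent X.X 1 IsIdempotentElem.one)⟩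

/-- Every element of `K₋₁(R)` is the class of an object, and an associated monic polynomial
governs its vanishing after base change and over `R`. -/
theorem exists_polynomial_of_kMinusOne (x : KMinusOne R) :
    ∃ f : Polynomial R, f.Monic ∧ Polynomial.X ^ 2 - Polynomial.X ∣ f ∧
      (f.HasIdempotentSplitting → x = 0) ∧
      ∀ (S : Type u) [CommRing S] [Algebra R S],
        (f.map (algebraMap R S)).HasIdempotentSplitting → KMinusOne.baseChange R S x = 0 := by
  obtain ⟨X, rfl⟩ := KZero.mk_surjective exists_kZeroMk_add_eq_zero x
  obtain ⟨φ, hφ⟩ := CalkinProj.homMk_surjective X.p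
  obtain ⟨f, hf, hd, h0⟩ := exists_monic_aeval_eq_zero_of_mem_finiteImageMaps
    (sq_sub_self_mem_finiteImageMaps X φ hφ)
  refine ⟨f, hf, hd, kZeroMk_eq_zero_of_hasIdempotentSplitting X φ hφ h0, fun S _ _ hs => ?_⟩
  rw [KMinusOne.baseChange, KZero.map_mk]
  refine kZeroMk_eq_zero_of_hasIdempotentSplitting _ (φ.baseChange S) ?_ ?_ hs
  · change _ = (CalkinProj.baseChange R S).map X.p
    rw [← hφ]
    rfl
  · exact aeval_baseChange_eq_zero S h0

end CalkinCategory

/-! ### The vanishing theorems -/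

-- $S$ is the product, over $0\le i\le\deg f$, of the algebras classifying factorizations with first
-- factor of degree $i$. Over the $i$-th stratum the section comes from the $i$-th factor, while
-- each factor carries its own universal splitting.
open Polynomial in
theorem exists_isNisnevichCovering_hasIdempotentSplitting {R : Type u} [CommRing R]
    {f : Polynomial R} (hf : f.Monic) (hd : X ^ 2 - X ∣ f) :
    ∃ (S : Type u) (_ : CommRing S) (_ : Algebra R S),
      IsNisnevichCovering (Spec.map (CommRingCat.ofHom (algebraMap R S))) ∧
        (f.map (algebraMap R S)).HasIdempotentSplitting := by
  let n := f.natDegree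
  let F : MonicDegreeEq R n := .mk f hf rfl
  have hn (i : Fin (n + 1)) : n = i + (n - i) := by omega
  let A (i : Fin (n + 1)) : Type u := SplittingFactorizationRing F i (n - i) (hn i)
  refine ⟨∀ i, A i, inferInstance, inferInstance, ?_, .pi fun i => ?_⟩
  · refine isNisnevichCovering_of_nonempty_algHom n f.coeff hf fun i hi B _ _ h0 hu => ?_
    obtain ⟨ψ⟩ := nonempty_splittingFactorizationRing_algHom_of_coeff F i (n - i)
      (hn ⟨i, Nat.lt_succ_of_le hi⟩) h0 hu
    exact ⟨ψ.comp (Pi.evalAlgHom R A ⟨i, Nat.lt_succ_of_le hi⟩)⟩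
  · rw [Polynomial.map_map]
    exact hasIdempotentSplitting_splittingFactorizationRing F i (n - i) (hn i) hd

open Polynomial IsLocalRing in
theorem HenselianLocalRing.hasIdempotentSplitting {R : Type u} [CommRing R]
    [HenselianLocalRing R] {f : Polynomial R} (hf : f.Monic) (hd : X ^ 2 - X ∣ f) :
    f.HasIdempotentSplitting := by
  classical
  let F : MonicDegreeEq R f.natDegree := .mk f hf rfl
  have hex : ∃ i, residue R (f.coeff i) ≠ 0 := ⟨f.natDegree, by simp [hf]⟩
  -- The order of vanishing at $0$ of $f$ modulo the maximal ideal: this degree of the first factor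
  -- provides the residue field point.
  let i := Nat.find hex
  have hi : f.natDegree = i + (f.natDegree - i) := by
    have : i ≤ f.natDegree := Nat.find_min' hex (by simp [hf])
    omega
  obtain ⟨φ⟩ := nonempty_splittingFactorizationRing_algHom_of_coeff (A := ResidueField R) F i _ hi
    (fun j hj => not_not.1 (Nat.find_min hex hj)) (IsUnit.mk0 _ (Nat.find_spec hex))
  obtain ⟨ψ⟩ := HenselianLocalRing.exists_algHom_of_etale φ
  have := (hasIdempotentSplitting_splittingFactorizationRing F i _ hi hd).map ψ.toRingHom
  rw [Polynomial.map_map] at this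
  convert this
  rw [AlgHom.toRingHom_eq_coe, ψ.comp_algebraMap]
  exact (Polynomial.map_id).symm

theorem mainTheorem4 (R : Type u) [CommRing R] :
    (∀ x : KMinusOne R, ∃ (S : Type u) (_ : CommRing S) (_ : Algebra R S),
      IsNisnevichCovering (Spec.map (CommRingCat.ofHom (algebraMap R S))) ∧
        KMinusOne.baseChange R S x = 0) ∧
    (HenselianLocalRing R → ∀ x : KMinusOne R, x = 0) := by
  refine ⟨fun x => ?_, fun _ x => ?_⟩
  · obtain ⟨f, hf, hd, -, h⟩ := CalkinCategory.exists_polynomial_of_kMinusOne x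
    obtain ⟨S, _, _, hS, hs⟩ := exists_isNisnevichCovering_hasIdempotentSplitting hf hd
    exact ⟨S, _, _, hS, h S hs⟩
  · obtain ⟨f, hf, hd, h, -⟩ := CalkinCategory.exists_polynomial_of_kMinusOne x
    exact h (HenselianLocalRing.hasIdempotentSplitting hf hd)
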